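/- Let $G$ be a finite connected cubic abelian Cayley graph, that is, a finite connected simple graph in which every vertex has degree $3$ and which is isomorphic to a Cayley graph $\mathrm{Cay}(A,S)$, where $A$ is an abelian group (written additively), $S\subseteq A\setminus\{0\}$ satisfies $S=-S$, and $x,y\in A$ are adjacent if and only if $y-x\in S$. Write $N(v)$ for the set of neighbours of $v$ and $N[v]=N(v)\cup\{v\}$. Let $\gamma(G)$ be the domination number of $G$, the minimum cardinality of a set $D\subseteq V(G)$ with $\bigcup_{v\in D}N[v]=V(G)$. Let $\gamma_{\mathrm m}^{\infty}(G)$ be the m-eternal domination number of $G$, the minimum cardinality of a set $D_1\subseteq V(G)$ starting from which a defender can answer every infinite sequence of attacks in the following game. In round $i\ge 1$ guards occupy the vertices of $D_i$, one guard on each vertex; an attacker, who knows $D_i$, chooses a vertex $v_i\notin D_i$; the defender then moves any number of guards, each along at most one edge, so that afterwards no two guards share a vertex and some guard is on $v_i$. The new set of occupied vertices is $D_{i+1}$. Let $\gamma_f^{\infty}(G)$ be the fractional eternal domination number of $G$, the infimum of all real numbers $s$ for which a defender can play forever in the following game. A state is a function $w\colon V(G)\to[0,\infty)$ with $\sum_{x\in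 N[v]}w(x)\ge 1$ for every $v\in V(G)$ and $\sum_{v\in V(G)}w(v)\le s$. The defender chooses an initial state $w_1$. In round $i\ge 1$ an attacker, who knows $w_i$, chooses a vertex $v_i$; the defender then chooses reals $m_{xy}\ge 0$ for all ordered pairs $(x,y)$ of adjacent vertices, with $\sum_{y\in N(x)}m_{xy}\le w_i(x)$ for every $x$, such that the function $$w_{i+1}(x)=w_i(x)-\sum_{y\in N(x)}m_{xy}+\sum_{y\in N(x)}m_{yx}$$ is again a state and $w_{i+1}(v_i)\ge 1$. Then $$\gamma_f^{\infty}(G)\le\gamma(G)=\gamma_{\mathrm m}^{\infty}(G).$$ Moreover, $\gamma_f^{\infty}(G)<\gamma(G)$ if and only if there is an integer $k\ge 1$ such that $G$ is isomorphic to the Cartesian product $C_{4k+2}\,\Box\,K_2$ or to $\mathrm{Cay}(\mathbb{Z}_{8k},\{1,-1,4k\})$. -/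

import Mathlib

open SimpleGraph

namespace EternalDomination

universe u

/-- The closed neighbourhood `N[v]`, as a finite set of vertices. -/
noncomputable def closedNbhd {V : Type u} [Fintype V] (G : SimpleGraph V) (v : V) : Finset V :=
  {x : V | x = v ∨ G.Adj v x}.toFinite.toFinset

/-- `D` is a dominating set: every vertex lies in `D` or has a neighbour in `D`. -/
def IsDominatingSet {V : Type u} (G : SimpleGraph V) (D : Finset V) : Prop :=
  ∀ v, ∃ x ∈ D, x = v ∨ G.Adj x v

/-- The domination number `γ(G)`. -/
noncomputable def domNumber {V : Type u} (G : SimpleGraph V) : ℕ :=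
  sInf {n : ℕ | ∃ D : Finset V, IsDominatingSet G D ∧ D.card = n}

/-- The guards on `D` can be moved to occupy exactly `D'`: every guard stays where it is or moves
to an adjacent vertex, and there is at most one guard on each vertex before and after. -/
def GuardMove {V : Type u} (G : SimpleGraph V) (D D' : Finset V) : Prop :=
  ∃ f : V → V, Set.BijOn f D D' ∧ ∀ u ∈ D, f u = u ∨ G.Adj u (f u)

/-- `D` is an m-eternal dominating set. A strategy `σ` of the defender assigns to each finite
history of attacks (most recent attack first) the set of occupied vertices; it starts from `D`
and answers each attack on an unoccupied vertex by a legal move of the guards after which the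
attacked vertex is occupied. -/
def IsMEternalDominatingSet {V : Type u} (G : SimpleGraph V) (D : Finset V) : Prop :=
  ∃ σ : List V → Finset V, σ [] = D ∧
    ∀ (h : List V) (v : V), v ∉ σ h → GuardMove G (σ h) (σ (v :: h)) ∧ v ∈ σ (v :: h)

/-- The m-eternal domination number `γ_m^∞(G)`. -/
noncomputable def mEternalDomNumber {V : Type u} (G : SimpleGraph V) : ℕ :=
  sInf {n : ℕ | ∃ D : Finset V, IsMEternalDominatingSet G D ∧ D.card = n}

/-- The non-negative weight function `w` dominates `G` fractionally (the weight of every closed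
neighbourhood is at least `1`), and its total weight is at most `S`. -/
def FracDominates {V : Type u} [Fintype V] (G : SimpleGraph V) (S : ℝ) (w : V → ℝ) : Prop :=
  (∀ v, 0 ≤ w v) ∧ (∀ v, 1 ≤ ∑ x ∈ closedNbhd G v, w x) ∧ ∑ v, w v ≤ S

/-- The weight function `w` can be turned into `w'` by moving, simultaneously for all ordered pairs
of adjacent vertices `x`, `y`, a weight `m x y ≥ 0` from `x` to `y`, where no vertex gives away
more than it has. -/
def WeightMove {V : Type u} [Fintype V] (G : SimpleGraph V) (w w' : V → ℝ) : Prop :=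
  ∃ m : V → V → ℝ, (∀ x y, 0 ≤ m x y) ∧ (∀ x y, ¬ G.Adj x y → m x y = 0) ∧
    (∀ x, ∑ y, m x y ≤ w x) ∧ ∀ x, w' x = w x - ∑ y, m x y + ∑ y, m y x

/-- `G` can be eternally `S`-fractionally dominated. A strategy `σ` of the defender assigns to each
finite history of attacks (most recent attack first) the current weight function; it always
dominates `G` fractionally with total weight at most `S`, and each attack is answered by a
legal move of weight after which the attacked vertex has weight at least `1`. -/
def EternallyFracDominated {V : Type u} [Fintype V] (G : SimpleGraph V) (S : ℝ) : Prop :=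
  ∃ σ : List V → V → ℝ, (∀ h, FracDominates G S (σ h)) ∧
    ∀ (h : List V) (v : V), WeightMove G (σ h) (σ (v :: h)) ∧ 1 ≤ σ (v :: h) v

/-- The fractional eternal domination number. -/
noncomputable def fed {V : Type u} [Fintype V] (G : SimpleGraph V) : ℝ :=
  sInf {S : ℝ | EternallyFracDominated G S}

/-- `G` is (isomorphic to) the Cayley graph `Cay(A, S)` of an abelian group `A`, with `S` an
inverse-closed subset of `A` not containing the identity. -/
def IsAbelianCayleyGraph {V : Type u} (G : SimpleGraph V) : Prop :=
  ∃ (A : Type u) (_ : AddCommGroup A) (S : Set A),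
    0 ∉ S ∧ (∀ s ∈ S, -s ∈ S) ∧ Nonempty (G ≃g addCayley S)

end EternalDomination

namespace EternalDomination

/-! ### Strategies, and counting bounds for both games. -/

section Game

variable {V : Type*} [Fintype V] {G : SimpleGraph V}

/-! In an abelian Cayley graph, translation by a generator moves every vertex along an edge and
preserves dominating sets. If `v` is attacked and `x` is a guard next to it, translating all guards
by `v - x` is a legal answer. Hence every dominating set is m-eternal dominating, and its indicator
functions give a fractional strategy: `domNumber_eq_mEternalDomNumber`,
`eternallyFracDominated_domNumber`.

For the strict inequality, the connection set is either three involutions, giving `K₄` or the cube,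
which are perfectly dominated, or `{a, -a, b}` with `2b = 0 ≠ 2a`. The latter graph is a cyclic
ladder of length `m` with `2m` vertices, where `m • a` is `0` (untwisted) or `b` (twisted). Double
counting gives total weight at least `|V| / 4 = m / 2`.

The natural sparse pattern consists of the knight moves `i • (2a + b)`. If `m = 2n` and `n • (2a +
b) = 0`, it closes up to a perfect dominating set, so both numbers equal `n`. If `m = 2n + 1`, it
gives `n + 1` guards; an attack puts weight `1` on one vertex, and `n` disjoint closed
neighbourhoods fit beside it, so `n + 1` is also a fractional lower bound.

The remaining case is `m = 2n` and `n • (2a + b) = b`. A dominating set of size `n` would be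
perfect, hence invariant under `2a + b`, hence would contain both ends of a rung, which is
impossible; so `γ ≥ n + 1` (`lt_domNumber`). But weight `n + 3/4` suffices: keep `1/4` everywhere
and an extra `3/4` on the attacked vertex, and move the extra weight along three internally disjoint
paths (`threeFlow`). By the parity of `n`, these ladders are the untwisted ones of length `4k + 2`
and the twisted ones of length `4k`; length and twist determine the graph (`nonempty_iso`). -/

theorem mem_closedNbhd {v x : V} : x ∈ closedNbhd G v ↔ x = v ∨ G.Adj v x := by
  simp [closedNbhd]

omit [Fintype V] in
theorem domNumber_le {D : Finset V} (hD : IsDominatingSet G D) : domNumber G ≤ D.card :=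
  Nat.sInf_le ⟨D, hD, rfl⟩

theorem exists_card_eq_domNumber (G : SimpleGraph V) :
    ∃ D : Finset V, IsDominatingSet G D ∧ D.card = domNumber G :=
  Nat.sInf_mem (s := {n : ℕ | ∃ D : Finset V, IsDominatingSet G D ∧ D.card = n})
    ⟨_, Finset.univ, fun v => ⟨v, Finset.mem_univ v, Or.inl rfl⟩, rfl⟩

omit [Fintype V] in
theorem IsMEternalDominatingSet.isDominatingSet {D : Finset V}
    (h : IsMEternalDominatingSet G D) : IsDominatingSet G D := by
  obtain ⟨σ, rfl, hσ⟩ := h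
  intro v
  by_cases hv : v ∈ σ []
  · exact ⟨v, hv, Or.inl rfl⟩
  · obtain ⟨⟨f, hf, hadj⟩, hv'⟩ := hσ [] v hv
    obtain ⟨u, hu, rfl⟩ := hf.surjOn hv'
    rcases hadj u hu with h | h
    · exact ⟨u, hu, Or.inl h.symm⟩
    · exact ⟨u, hu, Or.inr h⟩

omit [Fintype V] in
/-- A family of sets in which every attack can be answered consists of m-eternal dominating
sets. -/
theorem isMEternalDominatingSet_of_family (F : Finset V → Prop)
    (hF : ∀ D, F D → ∀ v, v ∉ D → ∃ D', F D' ∧ GuardMove G D D' ∧ v ∈ D')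
    {D : Finset V} (hD : F D) : IsMEternalDominatingSet G D := by
  classical
  choose! next h1 h2 h3 using hF
  -- An attack on an occupied vertex need not be answered, and `next` is unspecified there, so the
  -- set is kept in order to stay inside `F`.
  refine ⟨List.foldr (fun v E => if v ∈ E then E else next E v) D, rfl, fun h v hv => ?_⟩
  have key : ∀ h : List V, F (List.foldr (fun v E => if v ∈ E then E else next E v) D h) := by
    intro h
    induction h with
    | nil => exact hD
    | cons v h ih =>
      rw [List.foldr_cons]
      split_ifs with hv
      · exact ih
      · exact h1 _ ih v hv
  rw [List.foldr_cons, if_neg hv]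
  exact ⟨h2 _ (key h) v hv, h3 _ (key h) v hv⟩

theorem eternallyFracDominated_of_family {S : ℝ} (F : (V → ℝ) → Prop)
    (hdom : ∀ w, F w → FracDominates G S w)
    (hF : ∀ w, F w → ∀ v, ∃ w', F w' ∧ WeightMove G w w' ∧ 1 ≤ w' v)
    {w : V → ℝ} (hw : F w) : EternallyFracDominated G S := by
  choose! next h1 h2 h3 using hF
  have key : ∀ h : List V, F (List.foldr (fun v w => next w v) w h) := by
    intro h
    induction h with
    | nil => exact hw
    | cons v h ih => exact h1 _ ih v
  exact ⟨_, fun h => hdom _ (key h), fun h v => ⟨h2 _ (key h) v, h3 _ (key h) v⟩⟩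

theorem fed_le {S : ℝ} (h : EternallyFracDominated G S) : fed G ≤ S := by
  refine csInf_le ⟨0, ?_⟩ h
  rintro T ⟨σ, hσ, -⟩
  exact (Finset.sum_nonneg fun v _ => (hσ []).1 v).trans (hσ []).2.2

/-- A single attack at `v` already yields the bound: the state after it has weight at least `1` at
`v`. The assumption `hne` makes the infimum one over a nonempty set. -/
theorem le_fed {S T : ℝ} (hne : EternallyFracDominated G S) (v : V)
    (h : ∀ T' w, FracDominates G T' w → 1 ≤ w v → T ≤ ∑ x, w x) : T ≤ fed G := by
  refine le_csInf ⟨S, hne⟩ ?_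
  rintro T' ⟨σ, hσ, hm⟩
  exact (h T' (σ [v]) (hσ [v]) (hm [] v).2).trans (hσ [v]).2.2

theorem WeightMove.refl {w : V → ℝ} (hw : ∀ x, 0 ≤ w x) : WeightMove G w w :=
  ⟨fun _ _ => 0, by simp, by simp, by simpa using hw, by simp⟩

theorem card_closedNbhd [DecidableRel G.Adj] {d : ℕ} (hreg : G.IsRegularOfDegree d) (v : V) :
    (closedNbhd G v).card = d + 1 := by
  classical
  have h : closedNbhd G v = insert v (G.neighborFinset v) := by
    ext x; simp [mem_closedNbhd]
  rw [h, Finset.card_insert_of_notMem (by simp), G.card_neighborFinset_eq_degree, hreg v]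

theorem sum_closedNbhd_comm (w : V → ℝ) :
    ∑ v, ∑ x ∈ closedNbhd G v, w x = ∑ x, (closedNbhd G x).card * w x := by
  classical
  rw [Finset.sum_comm' (t' := Finset.univ) (s' := fun x => closedNbhd G x)]
  · simp
  · intro x y
    simp [mem_closedNbhd, adj_comm, eq_comm]

theorem card_le_mul_sum [DecidableRel G.Adj] {d : ℕ} (hreg : G.IsRegularOfDegree d)
    {w : V → ℝ} (hw : ∀ v, 1 ≤ ∑ x ∈ closedNbhd G v, w x) :
    (Fintype.card V : ℝ) ≤ (d + 1) * ∑ x, w x := by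
  have h1 : (Fintype.card V : ℝ) ≤ ∑ v, ∑ x ∈ closedNbhd G v, w x := by
    calc (Fintype.card V : ℝ) = ∑ v : V, (1 : ℝ) := by simp
      _ ≤ _ := Finset.sum_le_sum fun v _ => hw v
  rw [sum_closedNbhd_comm] at h1
  simpa [card_closedNbhd hreg, Finset.mul_sum] using h1

/-- A dominating set meeting the counting bound forces the fractional number to reach it. -/
theorem domNumber_le_fed_of_perfect [DecidableRel G.Adj] {d : ℕ} (hreg : G.IsRegularOfDegree d)
    {S : ℝ} (hS : EternallyFracDominated G S) (v : V) {D : Finset V} (hD : IsDominatingSet G D)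
    (hcard : (d + 1) * D.card ≤ Fintype.card V) : (domNumber G : ℝ) ≤ fed G := by
  have h1 : (domNumber G : ℝ) ≤ D.card := by exact_mod_cast domNumber_le hD
  have h2 : ((d : ℝ) + 1) * D.card ≤ Fintype.card V := by exact_mod_cast hcard
  refine h1.trans (le_fed hS v fun T' w hw _ => ?_)
  have h3 := h2.trans (card_le_mul_sum hreg hw.2.1)
  exact le_of_mul_le_mul_left h3 (by positivity)

end Game

/-! ### Translations as answers to attacks. -/

section Translation

variable {V : Type*} [Fintype V] [AddCommGroup V] {G : SimpleGraph V} {S : Set V}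

omit [Fintype V] in
theorem isDominatingSet_map_addRight (hadj : ∀ x y, G.Adj x y ↔ y - x ∈ S) {D : Finset V}
    (hD : IsDominatingSet G D) (t : V) :
    IsDominatingSet G (D.map (Equiv.addRight t).toEmbedding) := by
  intro v
  obtain ⟨x, hx, h⟩ := hD (v - t)
  refine ⟨x + t, by simpa using hx, h.imp (fun h => by rw [h, sub_add_cancel]) fun h => ?_⟩
  rw [hadj] at h ⊢
  rwa [show v - (x + t) = v - t - x by abel]

theorem weightMove_translate (s : V) (hs : ∀ x, G.Adj x (x + s)) {w : V → ℝ}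
    (hw : ∀ x, 0 ≤ w x) : WeightMove G w (fun x => w (x - s)) := by
  classical
  refine ⟨fun x y => if y = x + s then w x else 0, fun x y => ?_, fun x y h => ?_, fun x => ?_,
    fun x => ?_⟩
  · dsimp only; split_ifs
    · exact hw x
    · exact le_rfl
  · refine if_neg ?_
    rintro rfl
    exact h (hs x)
  · simp
  · have h : ∀ y, (if x = y + s then w y else 0) = if x - s = y then w y else 0 := fun y => by
      simp only [sub_eq_iff_eq_add]
    simp [h]

-- The guard next to the attacked vertex steps onto it, and all the others make the same step; the
-- new position is a translate of the old one.
omit [Fintype V] in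
theorem isMEternalDominatingSet_of_isDominatingSet (hadj : ∀ x y, G.Adj x y ↔ y - x ∈ S)
    {D : Finset V} (hD : IsDominatingSet G D) : IsMEternalDominatingSet G D := by
  refine isMEternalDominatingSet_of_family (fun E => IsDominatingSet G E) ?_ hD
  intro E hE v hv
  obtain ⟨x, hx, h⟩ := hE v
  rcases h with rfl | h
  · exact absurd hx hv
  refine ⟨_, isDominatingSet_map_addRight hadj hE (v - x), ⟨fun y => y + (v - x), ?_, ?_⟩, ?_⟩
  · rw [Finset.coe_map]
    exact (add_left_injective (v - x)).injOn.bijOn_image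
  · intro u _
    right
    rw [hadj] at h ⊢
    simpa using h
  · simpa using hx

theorem domNumber_eq_mEternalDomNumber (hadj : ∀ x y, G.Adj x y ↔ y - x ∈ S) :
    domNumber G = mEternalDomNumber G := by
  obtain ⟨D, hD, hc⟩ := exists_card_eq_domNumber G
  have hm := isMEternalDominatingSet_of_isDominatingSet hadj hD
  apply le_antisymm
  · refine le_csInf ⟨_, D, hm, hc⟩ ?_
    rintro n ⟨E, hE, rfl⟩
    exact domNumber_le hE.isDominatingSet
  · exact Nat.sInf_le ⟨D, hm, hc⟩

theorem eternallyFracDominated_domNumber (hadj : ∀ x y, G.Adj x y ↔ y - x ∈ S) :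
    EternallyFracDominated G (domNumber G : ℝ) := by
  classical
  obtain ⟨D, hD, hc⟩ := exists_card_eq_domNumber G
  let w : Finset V → V → ℝ := fun E x => if x ∈ E then 1 else 0
  have hw0 : ∀ E x, 0 ≤ w E x := fun E x => by dsimp only [w]; split_ifs <;> norm_num
  refine eternallyFracDominated_of_family
    (fun f => ∃ E, f = w E ∧ IsDominatingSet G E ∧ E.card = domNumber G) ?_ ?_ ⟨D, rfl, hD, hc⟩
  · rintro f ⟨E, rfl, hE, hcE⟩
    refine ⟨hw0 E, fun v => ?_, by simp [w, hcE]⟩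
    obtain ⟨x, hx, h⟩ := hE v
    calc (1 : ℝ) = w E x := by simp [w, hx]
      _ ≤ _ := Finset.single_le_sum (f := w E) (fun y _ => hw0 E y)
        (mem_closedNbhd.2 (h.imp id fun h => h.symm))
  · rintro f ⟨E, rfl, hE, hcE⟩ v
    obtain ⟨x, hx, h⟩ := hE v
    rcases h with rfl | h
    · exact ⟨w E, ⟨E, rfl, hE, hcE⟩, WeightMove.refl (hw0 E), by simp [w, hx]⟩
    have hE' : w (E.map (Equiv.addRight (v - x)).toEmbedding) = fun y => w E (y - (v - x)) := by
      funext y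
      have h : y ∈ E.map (Equiv.addRight (v - x)).toEmbedding ↔ y - (v - x) ∈ E := by
        rw [Finset.mem_map_equiv, Equiv.addRight_symm, sub_eq_add_neg y, Equiv.coe_addRight]
      simp only [w, h]
    refine ⟨_, ⟨_, rfl, isDominatingSet_map_addRight hadj hE (v - x), by simpa using hcE⟩, ?_, ?_⟩
    · rw [hE']
      refine weightMove_translate _ (fun y => ?_) (hw0 E)
      rw [hadj] at h ⊢
      simpa using h
    · rw [hE']
      simp [w, hx]

end Translation


/-! ### Cyclic ladders and their coordinates. -/

/-- `G` is the Cayley graph of an abelian group with respect to `{a, -a, b}`, where `b` is an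
involution, seen as a cyclic ladder: its rungs `{k • a, k • a + b}` are distinct for `0 ≤ k < m`,
and after `m` steps it closes up, with or without a twist. -/
structure IsLadder {V : Type*} [AddCommGroup V] (G : SimpleGraph V) (a b : V) (m : ℕ) : Prop where
  adj : ∀ x y, G.Adj x y ↔ y = x + a ∨ y = x - a ∨ y = x + b
  two_b : b + b = 0
  b_ne : b ≠ 0
  two_a : a + a ≠ 0
  period : (m : ℤ) • a = 0 ∨ (m : ℤ) • a = b
  minimal : ∀ d : ℤ, 0 < d → d < m → d • a ≠ 0 ∧ d • a ≠ b
  span : ∀ x, ∃ k : ℤ, x = k • a ∨ x = k • a + b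
  pos : 2 ≤ m

/-- The vertex in column `k` and row `j` of the ladder. -/
def lad {V : Type*} [AddCommGroup V] (a b : V) (k : ℤ) (j : Bool) : V :=
  k • a + if j then b else 0

namespace IsLadder

variable {V : Type*} [AddCommGroup V] {G : SimpleGraph V} {a b : V} {m : ℕ}

theorem neg_b (L : IsLadder G a b m) : -b = b := neg_eq_of_add_eq_zero_left L.two_b

theorem neg (L : IsLadder G a b m) : IsLadder G (-a) b m where
  adj x y := by
    rw [L.adj, sub_neg_eq_add, ← sub_eq_add_neg]
    tauto
  two_b := L.two_b
  b_ne := L.b_ne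
  two_a h := L.two_a (by rw [← neg_eq_zero, neg_add]; exact h)
  period := by
    rw [smul_neg, neg_eq_zero, neg_eq_iff_eq_neg, L.neg_b]
    exact L.period
  minimal d h1 h2 := by
    rw [smul_neg, ne_eq, ne_eq, neg_eq_zero, neg_eq_iff_eq_neg, L.neg_b]
    exact L.minimal d h1 h2
  span x := by
    obtain ⟨k, h⟩ := L.span x
    exact ⟨-k, by simpa using h⟩
  pos := L.pos

theorem lad_neg (k : ℤ) (j : Bool) : lad (-a) b k j = lad a b (-k) j := by simp [lad]

theorem lad_succ (k : ℤ) (j : Bool) : lad a b (k + 1) j = lad a b k j + a := by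
  simp only [lad, add_smul, one_smul]; abel

theorem lad_not (L : IsLadder G a b m) (k : ℤ) (j : Bool) :
    lad a b k (!j) = lad a b k j + b := by
  cases j <;> simp [lad, add_assoc, L.two_b]

theorem adj_succ (L : IsLadder G a b m) (k : ℤ) (j : Bool) :
    G.Adj (lad a b k j) (lad a b (k + 1) j) :=
  (L.adj _ _).2 (Or.inl (lad_succ k j))

theorem adj_not (L : IsLadder G a b m) (k : ℤ) (j : Bool) :
    G.Adj (lad a b k j) (lad a b k (!j)) :=
  (L.adj _ _).2 (Or.inr (Or.inr (L.lad_not k j)))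

theorem lad_add_period (h : (m : ℤ) • a = 0) (k : ℤ) (j : Bool) :
    lad a b (k + m) j = lad a b k j := by
  simp [lad, add_smul, h]

theorem lad_add_period_twist (L : IsLadder G a b m) (h : (m : ℤ) • a = b) (k : ℤ) (j : Bool) :
    lad a b (k + m) j = lad a b k (!j) := by
  rw [L.lad_not]
  simp only [lad, add_smul, h]
  abel

theorem eq_zero_of_smul (L : IsLadder G a b m) {d : ℤ} (hd : |d| < m)
    (h : d • a = 0 ∨ d • a = b) : d = 0 := by
  rcases lt_trichotomy d 0 with h0 | h0 | h0
  · rw [abs_of_neg h0] at hd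
    have := L.minimal (-d) (by omega) hd
    rw [neg_smul, ne_eq, ne_eq, neg_eq_zero, neg_eq_iff_eq_neg, L.neg_b] at this
    tauto
  · exact h0
  · rw [abs_of_pos h0] at hd
    have := L.minimal d h0 hd
    tauto

theorem lad_inj (L : IsLadder G a b m) {k l : ℤ} {i j : Bool} (h1 : |k - l| < m) :
    lad a b k i = lad a b l j ↔ k = l ∧ i = j := by
  refine ⟨fun h => ?_, fun h => by rw [h.1, h.2]⟩
  have hk : k - l = 0 := by
    refine L.eq_zero_of_smul h1 ?_
    have hb := L.neg_b
    rw [sub_smul]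
    cases i <;> cases j <;> simp only [lad, if_true, if_false, add_zero, Bool.false_eq_true] at h
    · left; rw [h, sub_self]
    · right; rw [h]; abel
    · right; rw [← h, ← sub_sub, sub_self, zero_sub, hb]
    · left; rw [add_right_cancel h, sub_self]
  obtain rfl : k = l := by omega
  refine ⟨rfl, ?_⟩
  have := L.b_ne
  cases i <;> cases j <;> simp_all [lad]

/-- Any window of `m` consecutive columns contains every vertex. -/
theorem exists_lad (L : IsLadder G a b m) (c : ℤ) (x : V) :
    ∃ k j, c ≤ k ∧ k < c + m ∧ lad a b k j = x := by
  have hm : (0 : ℤ) < m := by have := L.pos; omega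
  have h0 : ∃ k j, lad a b k j = x := by
    obtain ⟨k, rfl | rfl⟩ := L.span x
    · exact ⟨k, false, by simp [lad]⟩
    · exact ⟨k, true, by simp [lad]⟩
  obtain ⟨k, j, rfl⟩ := h0
  -- Shifting the column by a multiple of `m` changes at most the row, so the column can be reduced
  -- modulo `m` into the window.
  have hq : ∀ q : ℤ, ∀ k j, ∃ j', lad a b k j' = lad a b (k + m * q) j := by
    intro q
    have h1 : ∀ k j, ∃ j', lad a b k j' = lad a b (k + m) j := by
      intro k j
      rcases L.period with h | h
      · exact ⟨j, (lad_add_period h k j).symm⟩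
      · exact ⟨!j, (L.lad_add_period_twist h k j).symm⟩
    have h2 : ∀ k j, ∃ j', lad a b k j' = lad a b (k - m) j := by
      intro k j
      rcases L.period with h | h
      · exact ⟨j, by rw [← lad_add_period h (k - m) j, sub_add_cancel]⟩
      · exact ⟨!j, by
          have := L.lad_add_period_twist h (k - m) (!j)
          rwa [sub_add_cancel, Bool.not_not] at this⟩
    induction q with
    | zero => intro k j; exact ⟨j, by simp⟩
    | succ q ih =>
      intro k j
      obtain ⟨j', h⟩ := h1 (k + m * q) j
      obtain ⟨j'', h'⟩ := ih k j'
      exact ⟨j'', by rw [h', h]; congr 1; ring⟩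
    | pred q ih =>
      intro k j
      obtain ⟨j', h⟩ := h2 (k + m * (-q)) j
      obtain ⟨j'', h'⟩ := ih k j'
      exact ⟨j'', by rw [h', h]; congr 1; ring⟩
  obtain ⟨j', h⟩ := hq ((k - c) / m) (c + (k - c) % m) j
  refine ⟨_, j', by have := Int.emod_nonneg (k - c) hm.ne'; omega,
    by have := Int.emod_lt_of_pos (k - c) hm; omega, h.trans ?_⟩
  congr 1
  have := Int.emod_add_mul_ediv (k - c) m
  omega

/-- The vertices as pairs of a column and a row. -/
noncomputable def equiv (L : IsLadder G a b m) : Fin m × Bool ≃ V :=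
  Equiv.ofBijective (fun p => lad a b (p.1 : ℕ) p.2) <| by
    constructor
    · rintro ⟨k, i⟩ ⟨l, j⟩ h
      have h' := (L.lad_inj (by rw [abs_lt]; constructor <;> omega)).1 h
      exact Prod.ext (Fin.ext (by exact_mod_cast h'.1)) h'.2
    · intro x
      obtain ⟨k, j, h0, h1, rfl⟩ := L.exists_lad 0 x
      refine ⟨(⟨k.toNat, by omega⟩, j), ?_⟩
      dsimp only
      rw [Int.toNat_of_nonneg h0]

theorem equiv_apply (L : IsLadder G a b m) (p : Fin m × Bool) :
    L.equiv p = lad a b (p.1 : ℕ) p.2 := rfl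

variable [Fintype V]

theorem card_eq (L : IsLadder G a b m) : Fintype.card V = 2 * m := by
  rw [← Fintype.card_congr L.equiv]
  simp [mul_comm]

theorem sum_eq (L : IsLadder G a b m) (f : V → ℝ) :
    ∑ x, f x = ∑ k ∈ Finset.range m, (f (lad a b k false) + f (lad a b k true)) := by
  rw [← L.equiv.sum_comp, Fintype.sum_prod_type, Finset.sum_range]
  refine Finset.sum_congr rfl fun k _ => ?_
  simp [equiv_apply, add_comm]

theorem sum_closedNbhd {M : Type*} [AddCommMonoid M] (L : IsLadder G a b m) (f : V → M) (v : V) :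
    ∑ x ∈ closedNbhd G v, f x = f v + f (v + a) + f (v - a) + f (v + b) := by
  classical
  have h : closedNbhd G v = {v, v + a, v - a, v + b} := by
    ext x
    simp [mem_closedNbhd, L.adj]
  have ha : a ≠ 0 := fun h => L.two_a (by simp [h])
  have hab : a ≠ b := fun h => L.two_a (by rw [h, L.two_b])
  have haa : a ≠ -a := fun h => L.two_a (by nth_rewrite 1 [h]; simp)
  have hab' : -a ≠ b := fun h => L.two_a (by
    rw [← neg_eq_zero, neg_add, h, L.two_b])
  have hb := L.b_ne
  rw [h, Finset.sum_insert, Finset.sum_insert, Finset.sum_insert, Finset.sum_singleton, add_assoc,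
    add_assoc]
  · simpa [sub_eq_add_neg] using hab'
  · simp [sub_eq_add_neg, hab, haa]
  · simp [sub_eq_add_neg, ha, hb]

theorem isRegularOfDegree (L : IsLadder G a b m) [DecidableRel G.Adj] :
    G.IsRegularOfDegree 3 := by
  classical
  intro v
  have h1 : (closedNbhd G v).card = 4 := by
    rw [Finset.card_eq_sum_ones, L.sum_closedNbhd]
  have h2 : closedNbhd G v = insert v (G.neighborFinset v) := by
    ext x; simp [mem_closedNbhd]
  rw [h2, Finset.card_insert_of_notMem (by simp), G.card_neighborFinset_eq_degree] at h1
  omega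

omit [Fintype V] in
theorem adj_iff_sub_mem (L : IsLadder G a b m) (x y : V) :
    G.Adj x y ↔ y - x ∈ ({a, -a, b} : Set V) := by
  rw [L.adj]
  simp only [Set.mem_insert_iff, Set.mem_singleton_iff, sub_eq_iff_eq_add', ← sub_eq_add_neg]

theorem eternallyFracDominated (L : IsLadder G a b m) :
    EternallyFracDominated G (domNumber G : ℝ) :=
  eternallyFracDominated_domNumber L.adj_iff_sub_mem

end IsLadder

/-! ### Knight patterns and the domination number of ladders. -/

namespace IsLadder

variable {V : Type*} [AddCommGroup V] {G : SimpleGraph V} {a b : V} {m : ℕ}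

/-- The knight moves `i • (2a + b)` dominate all columns between them. -/
theorem exists_knight (L : IsLadder G a b m) (k : ℕ) (j : Bool) :
    ∃ i : ℕ, 2 * i ≤ k + 1 ∧ (lad a b (2 * (i : ℤ)) i.bodd = lad a b k j ∨
      G.Adj (lad a b (2 * (i : ℤ)) i.bodd) (lad a b k j)) := by
  obtain ⟨i, rfl | rfl⟩ := Nat.even_or_odd' k
  · refine ⟨i, by omega, ?_⟩
    push_cast
    rcases Bool.eq_or_eq_not j i.bodd with h | h
    · left; rw [h]
    · right; rw [h]; exact L.adj_not _ _
  · push_cast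
    rcases Bool.eq_or_eq_not j i.bodd with h | h
    · refine ⟨i, by omega, Or.inr ?_⟩
      rw [h]
      exact L.adj_succ _ _
    · refine ⟨i + 1, by omega, Or.inr (SimpleGraph.Adj.symm ?_)⟩
      rw [h, Nat.bodd_succ]
      convert L.adj_succ (2 * (i : ℤ) + 1) (!i.bodd) using 2
      push_cast; ring

theorem isDominatingSet_knight_of_odd [DecidableEq V] {n : ℕ} (L : IsLadder G a b (2 * n + 1)) :
    IsDominatingSet G ((Finset.range (n + 1)).image fun i : ℕ => lad a b (2 * (i : ℤ)) i.bodd) := by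
  intro x
  obtain ⟨k, j, h0, h1, rfl⟩ := L.exists_lad 0 x
  lift k to ℕ using h0
  obtain ⟨i, hi, h⟩ := L.exists_knight k j
  exact ⟨_, Finset.mem_image_of_mem _ (Finset.mem_range.2 (by omega)), h⟩

/-- The last column may need the knight number `n`, which by `hn` is the knight number `0` again. -/
theorem isDominatingSet_knight_of_even [DecidableEq V] {n : ℕ} (L : IsLadder G a b (2 * n))
    (hn : lad a b (2 * (n : ℤ)) n.bodd = 0) :
    IsDominatingSet G ((Finset.range n).image fun i : ℕ => lad a b (2 * (i : ℤ)) i.bodd) := by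
  intro x
  obtain ⟨k, j, h0, h1, rfl⟩ := L.exists_lad 0 x
  lift k to ℕ using h0
  obtain ⟨i, hi, h⟩ := L.exists_knight k j
  rcases Nat.lt_or_ge i n with hin | hin
  · exact ⟨_, Finset.mem_image_of_mem _ (Finset.mem_range.2 hin), h⟩
  · obtain rfl : i = n := by omega
    have := L.pos
    rw [hn] at h
    refine ⟨0, Finset.mem_image.2 ⟨0, Finset.mem_range.2 (by omega), by simp [lad]⟩, h⟩

variable [Fintype V]

theorem domNumber_le_fed_of_even {n : ℕ} (L : IsLadder G a b (2 * n))
    (hn : lad a b (2 * (n : ℤ)) n.bodd = 0) : (domNumber G : ℝ) ≤ fed G := by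
  classical
  refine domNumber_le_fed_of_perfect L.isRegularOfDegree L.eternallyFracDominated 0
    (L.isDominatingSet_knight_of_even hn) ?_
  rw [L.card_eq]
  have := Finset.card_image_le (s := Finset.range n)
    (f := fun i : ℕ => lad a b (2 * (i : ℤ)) i.bodd)
  rw [Finset.card_range] at this
  omega

/-- The columns `0, …, 2n` split into the vertex `0`, the closed neighbourhoods of `n` vertices in
the odd columns with alternating rows, and one vertex left over in column `2n`. -/
theorem sum_packing (L : IsLadder G a b m) (w : V → ℝ) (n : ℕ) :
    w 0 + ∑ i ∈ Finset.range n, ∑ x ∈ closedNbhd G (lad a b (2 * (i : ℤ) + 1) (!i.bodd)), w x +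
      w (lad a b (2 * (n : ℤ)) (!n.bodd)) =
    ∑ k ∈ Finset.range (2 * n + 1), (w (lad a b k false) + w (lad a b k true)) := by
  induction n with
  | zero => simp [lad]
  | succ n ih =>
    rw [show 2 * (n + 1) + 1 = 2 * n + 1 + 1 + 1 by ring, 
      Finset.sum_range_succ _ (2 * n + 1 + 1), Finset.sum_range_succ _ (2 * n + 1), ← ih,
      Finset.sum_range_succ, L.sum_closedNbhd,
      ← lad_succ, ← L.lad_not, Bool.not_not, Nat.bodd_succ, Bool.not_not]
    have h : lad a b (2 * (n : ℤ) + 1) (!n.bodd) - a = lad a b (2 * (n : ℤ)) (!n.bodd) := by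
      rw [lad_succ, add_sub_cancel_right]
    rw [h]
    push_cast
    rw [show (2 * ((n : ℤ) + 1)) = 2 * n + 1 + 1 by ring]
    cases n.bodd <;> simp only [Bool.not_true, Bool.not_false] <;> ring

theorem domNumber_le_fed_of_odd {n : ℕ} (L : IsLadder G a b (2 * n + 1)) :
    (domNumber G : ℝ) ≤ fed G := by
  classical
  have h1 : domNumber G ≤ n + 1 := by
    refine (domNumber_le L.isDominatingSet_knight_of_odd).trans ?_
    exact Finset.card_image_le.trans (Finset.card_range _).le
  refine le_trans (by exact_mod_cast h1) (le_fed L.eternallyFracDominated 0 (T := (n : ℝ) + 1) ?_)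
  intro T' w hw h0
  rw [L.sum_eq, ← L.sum_packing w n]
  have h2 : (n : ℝ) ≤
      ∑ i ∈ Finset.range n, ∑ x ∈ closedNbhd G (lad a b (2 * (i : ℤ) + 1) (!i.bodd)), w x := by
    calc (n : ℝ) = ∑ i ∈ Finset.range n, (1 : ℝ) := by simp
      _ ≤ _ := Finset.sum_le_sum fun i _ => hw.2.1 _
  linarith [hw.1 (lad a b (2 * (n : ℤ)) (!n.bodd))]

/-- A dominating set of size at most `n` would dominate each of the `4n` vertices exactly once.
Perfection propagates along `2a + b`, and `n` such steps lead from `x` to `x + b`, so `x` would be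
dominated twice. -/
theorem lt_domNumber {n : ℕ} (L : IsLadder G a b (2 * n))
    (hn : lad a b (2 * (n : ℤ)) n.bodd = b) : n < domNumber G := by
  classical
  obtain ⟨D, hD, hc⟩ := exists_card_eq_domNumber G
  by_contra! hle
  let f : V → ℕ := fun x => if x ∈ D then 1 else 0
  have hf1 : ∀ v, 1 ≤ f v + f (v + a) + f (v - a) + f (v + b) := by
    intro v
    rw [← L.sum_closedNbhd]
    obtain ⟨x, hx, h⟩ := hD v
    calc 1 = f x := by simp [f, hx]
      _ ≤ _ := Finset.single_le_sum (f := f) (fun _ _ => Nat.zero_le _)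
        (mem_closedNbhd.2 (h.imp id fun h => h.symm))
  have hsum : ∑ v, (f v + f (v + a) + f (v - a) + f (v + b)) = 4 * D.card := by
    have h1 : ∑ v, f (v + a) = ∑ v, f v := Equiv.sum_comp (Equiv.addRight a) f
    have h2 : ∑ v, f (v - a) = ∑ v, f v := (Equiv.subRight a).sum_comp f
    have h3 : ∑ v, f (v + b) = ∑ v, f v := Equiv.sum_comp (Equiv.addRight b) f
    have h4 : ∑ v, f v = D.card := by simp [f]
    rw [Finset.sum_add_distrib, Finset.sum_add_distrib, Finset.sum_add_distrib, h1, h2, h3, h4]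
    ring
  have hone : ∑ _v : V, 1 = 2 * (2 * n) := by simp [L.card_eq]
  have hf : ∀ v, 1 = f v + f (v + a) + f (v - a) + f (v + b) := by
    have := (Finset.sum_eq_sum_iff_of_le (s := Finset.univ) fun v _ => hf1 v).1 (by
      have := Finset.sum_le_sum (s := Finset.univ) fun v _ => hf1 v
      omega)
    exact fun v => this v (Finset.mem_univ v)
  have hb : ∀ v, v + b + b = v := fun v => by rw [add_assoc, L.two_b, add_zero]
  -- Exactness at `v` and at `v + b` leaves `v + a`, `v + b` and `v + a + b` unoccupied, so only `v
  -- + 2a + b` can dominate `v + a + b`.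
  have hstep : ∀ v, f v = 1 → f (v + a + a + b) = 1 := by
    intro v hv
    have h1 := hf v
    have h2 := hf (v + b)
    have h3 := hf (v + a + b)
    rw [hb] at h2 h3
    rw [show v + b + a = v + a + b by abel] at h2
    rw [show v + a + b + a = v + a + a + b by abel, show v + a + b - a = v + b by abel] at h3
    omega
  obtain ⟨x, hx, -⟩ := hD 0
  have hall : ∀ i : ℕ, f (x + lad a b (2 * (i : ℤ)) i.bodd) = 1 := by
    intro i
    induction i with
    | zero => simp [lad, f, hx]
    | succ i ih =>
      have := hstep _ ih
      rw [Nat.bodd_succ, L.lad_not]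
      convert this using 2
      push_cast
      rw [mul_add, mul_one, show 2 * (i : ℤ) + 2 = 2 * i + 1 + 1 by ring, lad_succ, lad_succ]
      abel
  have h1 := hall n
  rw [hn] at h1
  have h2 := hall 0
  rw [show lad a b (2 * ((0 : ℕ) : ℤ)) (Nat.bodd 0) = 0 by simp [lad], add_zero] at h2
  have := hf x
  omega

end IsLadder

/-! ### Flows of weight along edge-paths. -/

/-- There is a flow of weight along the edges of `G` that leaves every vertex `x` with
multiplicity `o x` and has divergence `-δ`. -/
def IsFlow {V : Type*} [Fintype V] (G : SimpleGraph V) (o : V → ℕ) (δ : V → ℝ) : Prop :=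
  ∃ m : V → V → ℝ, (∀ x y, 0 ≤ m x y) ∧ (∀ x y, ¬ G.Adj x y → m x y = 0) ∧
    (∀ x, ∑ y, m x y = o x) ∧ ∀ x, ∑ y, m y x - ∑ y, m x y = δ x

namespace IsFlow

variable {V : Type*} [Fintype V] {G : SimpleGraph V}

theorem zero : IsFlow G 0 0 := ⟨0, by simp, by simp, by simp, by simp⟩

theorem add {o₁ o₂ : V → ℕ} {δ₁ δ₂ : V → ℝ} (h₁ : IsFlow G o₁ δ₁) (h₂ : IsFlow G o₂ δ₂) :
    IsFlow G (o₁ + o₂) (δ₁ + δ₂) := by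
  obtain ⟨m₁, a₁, b₁, c₁, d₁⟩ := h₁
  obtain ⟨m₂, a₂, b₂, c₂, d₂⟩ := h₂
  refine ⟨m₁ + m₂, fun x y => add_nonneg (a₁ x y) (a₂ x y), fun x y h => ?_, fun x => ?_,
    fun x => ?_⟩
  · simp [b₁ x y h, b₂ x y h]
  · simp [Finset.sum_add_distrib, c₁, c₂]
  · simp only [Pi.add_apply, Finset.sum_add_distrib, ← d₁, ← d₂]
    ring

variable [DecidableEq V]

theorem edge {x y : V} (h : G.Adj x y) :
    IsFlow G (Pi.single x 1) (Pi.single y 1 - Pi.single x 1) := by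
  refine ⟨fun u v => (Pi.single x 1 : V → ℝ) u * (Pi.single y 1 : V → ℝ) v, fun u v => ?_,
    fun u v huv => ?_, fun u => ?_, fun u => ?_⟩
  · simp only [Pi.single_apply]
    positivity
  · by_contra h0
    have hu : u = x := by by_contra hu; simp [hu] at h0
    have hv : v = y := by by_contra hv; simp [hv] at h0
    exact huv (hu ▸ hv ▸ h)
  · rw [← Finset.mul_sum]
    simp [Pi.single_apply]
  · rw [← Finset.mul_sum, ← Finset.sum_mul]
    simp [Pi.single_apply]

omit [DecidableEq V] in
theorem weightMove {o : V → ℕ} {δ : V → ℝ} (h : IsFlow G o δ) {c : ℝ} (hc : 0 ≤ c) {w : V → ℝ}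
    (hw : ∀ x, c * o x ≤ w x) : WeightMove G w (w + c • δ) := by
  obtain ⟨m, h1, h2, h3, h4⟩ := h
  refine ⟨fun x y => c * m x y, fun x y => mul_nonneg hc (h1 x y), fun x y h => ?_, fun x => ?_,
    fun x => ?_⟩
  · simp [h2 x y h]
  · rw [← Finset.mul_sum, h3]
    exact hw x
  · rw [← Finset.mul_sum, ← Finset.mul_sum, Pi.add_apply, Pi.smul_apply, ← h4, smul_eq_mul]
    ring

end IsFlow

/-- Three units can flow from `x` to `y` along paths that are disjoint outside `x` and `y`. -/
def ThreeFlow {V : Type*} [Fintype V] [DecidableEq V] (G : SimpleGraph V) (x y : V) : Prop :=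
  ∃ o : V → ℕ, IsFlow G o (3 • (Pi.single y 1 - Pi.single x 1)) ∧
    ∀ z, o z ≤ 1 + 3 * (Pi.single x 1 : V → ℕ) z

section

variable {V : Type*} [Fintype V] [DecidableEq V] {G : SimpleGraph V}

theorem ThreeFlow.intro {x y : V} {o : V → ℕ} {δ : V → ℝ} (h : IsFlow G o δ)
    (hδ : δ = 3 • (Pi.single y 1 - Pi.single x 1))
    (ho : ∀ z, o z ≤ 1 + 3 * (Pi.single x 1 : V → ℕ) z) : ThreeFlow G x y :=
  ⟨o, hδ ▸ h, ho⟩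

theorem ThreeFlow.translate [AddCommGroup V] {S : Set V} (hadj : ∀ x y, G.Adj x y ↔ y - x ∈ S)
    {x y : V} (h : ThreeFlow G x y) (t : V) : ThreeFlow G (x + t) (y + t) := by
  obtain ⟨o, ⟨m, h1, h2, h3, h4⟩, ho⟩ := h
  refine ⟨fun z => o (z - t), ⟨fun u v => m (u - t) (v - t), fun _ _ => h1 _ _, fun u v huv => ?_,
    fun u => ?_, fun u => ?_⟩, fun z => ?_⟩
  · refine h2 _ _ fun h => huv ?_
    rw [hadj] at h ⊢
    simpa using h
  · rw [← h3]
    exact (Equiv.subRight t).sum_comp fun v => m (u - t) v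
  · have e1 := (Equiv.subRight t).sum_comp fun v => m (u - t) v
    have e2 := (Equiv.subRight t).sum_comp fun v => m v (u - t)
    simp only [Equiv.subRight_apply] at e1 e2
    rw [e1, e2, h4]
    simp [Pi.single_apply, sub_eq_iff_eq_add]
  · simpa [Pi.single_apply, sub_eq_iff_eq_add] using ho (z - t)

theorem ThreeFlow.refl (x : V) : ThreeFlow G x x :=
  ⟨0, by simpa using IsFlow.zero, by simp⟩

/-- If any two vertices are joined by three disjoint paths, the weight functions
`1 / 4 + 3 / 4 • 1_v` form an eternal strategy. -/
theorem eternallyFracDominated_of_threeFlow [DecidableRel G.Adj] (hreg : G.IsRegularOfDegree 3)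
    [Nonempty V] (h : ∀ x y, ThreeFlow G x y) :
    EternallyFracDominated G ((Fintype.card V : ℝ) / 4 + 3 / 4) := by
  let w : V → V → ℝ := fun v x => 1 / 4 + 3 / 4 * (Pi.single v 1 : V → ℝ) x
  have hw : ∀ v x, 1 / 4 ≤ w v x := fun v x => by
    simp only [w, Pi.single_apply]
    split_ifs <;> norm_num
  obtain ⟨v₀⟩ := ‹Nonempty V›
  refine eternallyFracDominated_of_family (fun f => ∃ v, f = w v) ?_ ?_ ⟨v₀, rfl⟩
  · rintro f ⟨v, rfl⟩
    refine ⟨fun x => le_trans (by norm_num) (hw v x), fun u => ?_, ?_⟩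
    · calc (1 : ℝ) = ∑ x ∈ closedNbhd G u, (1 / 4 : ℝ) := by
            rw [Finset.sum_const, card_closedNbhd hreg]; norm_num
        _ ≤ _ := Finset.sum_le_sum fun x _ => hw v x
    · simp only [w, Finset.sum_add_distrib, ← Finset.mul_sum]
      simp [div_eq_mul_inv]
  · rintro f ⟨v, rfl⟩ u
    refine ⟨w u, ⟨u, rfl⟩, ?_, by simp only [w, Pi.single_eq_same]; norm_num⟩
    obtain ⟨o, ho, hle⟩ := h v u
    have hu : w u = w v + (1 / 4 : ℝ) • (3 • (Pi.single u 1 - Pi.single v 1 : V → ℝ)) := by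
      funext x
      simp only [w, Pi.add_apply, Pi.smul_apply, Pi.sub_apply, smul_eq_mul]
      ring
    rw [hu]
    refine ho.weightMove (by norm_num) fun x => ?_
    have h1 := hle x
    simp only [w, Pi.single_apply] at h1 ⊢
    have h2 : (o x : ℝ) ≤ 1 + 3 * if x = v then 1 else 0 := by exact_mod_cast h1
    linarith

end

/-! ### Three disjoint paths in a ladder. -/

namespace IsLadder

variable {V : Type*} [AddCommGroup V] {G : SimpleGraph V} {a b : V} {m : ℕ} [Fintype V]
  [DecidableEq V]

theorem flow_right (L : IsLadder G a b m) (c : ℤ) (n : ℕ) (r : Bool) :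
    IsFlow G (∑ k ∈ Finset.Ico c (c + n), Pi.single (lad a b k r) 1)
      (Pi.single (lad a b (c + n) r) 1 - Pi.single (lad a b c r) 1) := by
  induction n with
  | zero => simpa using IsFlow.zero
  | succ n ih =>
    have h := ih.add (IsFlow.edge (L.adj_succ (c + n) r))
    push_cast
    rw [← add_assoc, ← Finset.insert_Ico_right_eq_Ico_add_one (by omega),
      Finset.sum_insert (by simp)]
    convert h using 1 <;> abel

theorem flow_left (L : IsLadder G a b m) (c : ℤ) (n : ℕ) (r : Bool) :
    IsFlow G (∑ k ∈ Finset.Ico (c - n + 1) (c + 1), Pi.single (lad a b k r) 1)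
      (Pi.single (lad a b (c - n) r) 1 - Pi.single (lad a b c r) 1) := by
  induction n with
  | zero => simpa using IsFlow.zero
  | succ n ih =>
    have h := ih.add (IsFlow.edge (L.adj_succ (c - n - 1) r).symm)
    push_cast
    rw [sub_add_cancel] at h
    rw [show c - ((n : ℤ) + 1) = c - n - 1 by ring, sub_add_cancel,
      ← Finset.insert_Ico_add_one_left_eq_Ico (a := c - n) (by omega), Finset.sum_insert (by simp)]
    convert h using 1 <;> abel

omit [Fintype V] in
theorem single_lad (L : IsLadder G a b m) {k l : ℤ} {i j : Bool} (h : |k - l| < m) :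
    (Pi.single (lad a b k i) 1 : V → ℕ) (lad a b l j) = if k = l ∧ i = j then 1 else 0 := by
  rw [Pi.single_apply]
  refine if_congr ?_ rfl rfl
  rw [eq_comm, L.lad_inj h]

omit [Fintype V] in
theorem run_lad (L : IsLadder G a b m) {c d e l : ℤ} {r j : Bool} (h1 : e ≤ c) (h2 : d ≤ e + m)
    (h3 : e ≤ l) (h4 : l < e + m) :
    (∑ k ∈ Finset.Ico c d, Pi.single (lad a b k r) 1 : V → ℕ) (lad a b l j) =
      if c ≤ l ∧ l < d ∧ r = j then 1 else 0 := by
  rw [Finset.sum_apply]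
  have : ∀ k ∈ Finset.Ico c d, (Pi.single (lad a b k r) 1 : V → ℕ) (lad a b l j) =
      if k = l then (if r = j then 1 else 0) else 0 := by
    intro k hk
    rw [Finset.mem_Ico] at hk
    rw [L.single_lad (by rw [abs_lt]; constructor <;> omega), ite_and]
  rw [Finset.sum_congr rfl this, Finset.sum_ite_eq']
  simp only [Finset.mem_Ico, ite_and]

/-- The paths are the rung itself and the detours through columns `1` and `-1`, which are distinct
because `3 ≤ m`. -/
theorem threeFlow_rung (L : IsLadder G a b m) (hm : 3 ≤ m) :
    ThreeFlow G (lad a b 0 false) (lad a b 0 true) := by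
  refine ThreeFlow.intro ((((((IsFlow.edge (L.adj_not 0 false)).add
    (IsFlow.edge (L.adj_succ 0 false))).add (IsFlow.edge (L.adj_not (0 + 1) false))).add
    (IsFlow.edge (L.adj_succ 0 true).symm)).add
    ((IsFlow.edge (L.adj_succ (-1) false).symm).add (IsFlow.edge (L.adj_not (-1) false)))).add
    (IsFlow.edge (L.adj_succ (-1) true))) ?_ fun z => ?_
  · simp only [Bool.not_false, neg_add_cancel]
    abel
  · obtain ⟨l, j, h0, h1, rfl⟩ := L.exists_lad (-1) z
    simp only [Pi.add_apply, neg_add_cancel]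
    rw [L.single_lad, L.single_lad, L.single_lad, L.single_lad, L.single_lad]
    · cases j <;> simp <;> split_ifs <;> omega
    all_goals rw [abs_lt]; constructor <;> omega

/-- The paths go right in the row, left in the row around the cycle, and right through the other
row. -/
theorem threeFlow_same_row {i n : ℕ} (L : IsLadder G a b (i + n)) (hn : 1 ≤ n)
    (h : ((i + n : ℕ) : ℤ) • a = 0) :
    ThreeFlow G (lad a b 0 false) (lad a b i false) := by
  refine ThreeFlow.intro ((((L.flow_right 0 i false).add (L.flow_left 0 n false)).add
    (IsFlow.edge (L.adj_not 0 false))).add ((L.flow_right 0 i true).add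
    (IsFlow.edge (L.adj_not i true)))) ?_ fun z => ?_
  · have h1 : lad a b (0 - n) false = lad a b i false := by
      rw [← lad_add_period h]
      congr 1
      push_cast; ring
    simp only [Bool.not_false, Bool.not_true, h1, zero_add]
    abel
  · obtain ⟨l, j, h0, h1, rfl⟩ := L.exists_lad (1 - n) z
    simp only [Pi.add_apply]
    rw [L.run_lad (e := 1 - n), L.run_lad (e := 1 - n), L.run_lad (e := 1 - n), L.single_lad,
      L.single_lad]
    · cases j <;> simp <;> split_ifs <;> omega
    all_goals first | omega | (rw [abs_lt]; constructor <;> omega)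

/-- Two paths go right, crossing at the end or at the start. The third goes left to column `-n`,
which is column `i + 1`, crosses there, and takes one more step; `1 ≤ n` keeps this rung away from
column `0`. -/
theorem threeFlow_other_row {i n : ℕ} (L : IsLadder G a b (i + (n + 1))) (hn : 1 ≤ n)
    (h : ((i + (n + 1) : ℕ) : ℤ) • a = 0) :
    ThreeFlow G (lad a b 0 false) (lad a b i true) := by
  refine ThreeFlow.intro ((((L.flow_right 0 i false).add (IsFlow.edge (L.adj_not i false))).add
    ((IsFlow.edge (L.adj_not 0 false)).add (L.flow_right 0 i true))).add
    (((L.flow_left 0 n false).add (IsFlow.edge (L.adj_not (0 - n) false))).add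
    (L.flow_left (0 - n) 1 true))) ?_ fun z => ?_
  · have h1 : lad a b (0 - n - (1 : ℕ)) true = lad a b i true := by
      rw [← lad_add_period h]
      congr 1
      push_cast; ring
    simp only [Bool.not_false, h1, zero_add]
    abel
  · obtain ⟨l, j, h0, h1, rfl⟩ := L.exists_lad (-n) z
    simp only [Pi.add_apply]
    rw [L.run_lad (e := -n), L.run_lad (e := -n), L.run_lad (e := -n), L.run_lad (e := -n),
      L.single_lad, L.single_lad, L.single_lad]
    · cases j <;> simp <;> split_ifs <;> omega
    all_goals first | omega | (rw [abs_lt]; constructor <;> omega)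

/-- Because of the twist the target is also the vertex in column `-n` and row `true`. One path goes
right, and two go left, crossing at the end or at the start. -/
theorem threeFlow_twist {i n : ℕ} (L : IsLadder G a b (i + n)) (hi : 1 ≤ i)
    (h : ((i + n : ℕ) : ℤ) • a = b) :
    ThreeFlow G (lad a b 0 false) (lad a b i false) := by
  refine ThreeFlow.intro (((L.flow_right 0 i false).add ((L.flow_left 0 n false).add
    (IsFlow.edge (L.adj_not (0 - n) false)))).add
    ((IsFlow.edge (L.adj_not 0 false)).add (L.flow_left 0 n true))) ?_ fun z => ?_
  · have h1 : lad a b (0 - n) true = lad a b i false := by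
      rw [← Bool.not_false, ← L.lad_add_period_twist h]
      congr 1
      push_cast; ring
    simp only [Bool.not_false, h1, zero_add]
    abel
  · obtain ⟨l, j, h0, h1, rfl⟩ := L.exists_lad (-n) z
    simp only [Pi.add_apply]
    rw [L.run_lad (e := -n), L.run_lad (e := -n), L.run_lad (e := -n),
      L.single_lad, L.single_lad]
    · cases j <;> simp <;> split_ifs <;> omega
    all_goals first | omega | (rw [abs_lt]; constructor <;> omega)

theorem threeFlow_lad (L : IsLadder G a b m) (hm : 3 ≤ m) (k : ℤ) (hk0 : 0 ≤ k) (hk : k < m)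
    (j : Bool) : ThreeFlow G (lad a b 0 false) (lad a b k j) := by
  lift k to ℕ using hk0
  obtain ⟨n, rfl⟩ := Nat.exists_eq_add_of_lt (Int.ofNat_lt.1 hk)
  rw [add_assoc] at L hm
  have h0 : lad a b 0 false = lad (-a) b 0 false := by simp [lad]
  rcases Nat.eq_zero_or_pos k with rfl | hk1
  · cases j
    · exact ThreeFlow.refl _
    · exact L.threeFlow_rung hm
  have hL : k + (n + 1) = (n + 1) + k := add_comm _ _
  rcases L.period with h | h <;> cases j
  · exact L.threeFlow_same_row (by omega) h
  -- For `n = 0` the target lies in column `-1`; the reflection `a ↦ -a` puts it in column `1`,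
  -- where `3 ≤ m` leaves enough room.
  · rcases Nat.eq_zero_or_pos n with rfl | hn
    · have h2 : lad a b (k : ℕ) true = lad (-a) b ((0 + 1 : ℕ) : ℤ) true := by
        rw [lad_neg, ← lad_add_period h (-_)]
        congr 1
        push_cast; ring
      obtain ⟨k, rfl⟩ : ∃ l, k = l + 1 := ⟨k - 1, by omega⟩
      rw [hL] at L h
      rw [h0, h2]
      exact L.neg.threeFlow_other_row (by omega) (by rw [smul_neg, h, neg_zero])
    · exact L.threeFlow_other_row hn h
  · exact L.threeFlow_twist hk1 h
  -- Running backwards through the twist, the target lies in row `false` of the reflected ladder.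
  · have h2 : lad a b k true = lad (-a) b ((n + 1 : ℕ) : ℤ) false := by
      rw [lad_neg, ← Bool.not_true, ← L.lad_add_period_twist h]
      congr 1
      push_cast; ring
    rw [hL] at L h
    rw [h0, h2]
    exact L.neg.threeFlow_twist (by omega) (by rw [smul_neg, h, L.neg_b])

theorem threeFlow (L : IsLadder G a b m) (hm : 3 ≤ m) (x y : V) : ThreeFlow G x y := by
  obtain ⟨k, j, hk0, hk, h⟩ := L.exists_lad 0 (y - x)
  have := L.threeFlow_lad hm k hk0 (by omega) j
  rw [h, show lad a b 0 false = 0 by simp [lad]] at this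
  have h2 := this.translate L.adj_iff_sub_mem x
  rwa [zero_add, sub_add_cancel] at h2

theorem fed_lt_domNumber {n : ℕ} (L : IsLadder G a b (2 * n))
    (hn : lad a b (2 * (n : ℤ)) n.bodd = b) : fed G < domNumber G := by
  classical
  -- For `n = 1` the hypothesis `hn` reads `2a + b = b`, contradicting `2a ≠ 0`.
  have hm : 3 ≤ 2 * n := by
    by_contra! h
    obtain rfl : n = 1 := by have := L.pos; omega
    apply L.two_a
    simpa [lad, two_smul] using hn
  have h1 := L.lt_domNumber hn
  have h2 := fed_le (eternallyFracDominated_of_threeFlow L.isRegularOfDegree (L.threeFlow hm))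
  rw [L.card_eq] at h2
  have h3 : (n : ℝ) + 1 ≤ domNumber G := by exact_mod_cast h1
  push_cast at h2
  linarith

end IsLadder

/-! ### Ladders up to isomorphism. -/

namespace IsLadder

section Iso

variable {V V' : Type*} [AddCommGroup V] [AddCommGroup V'] {G : SimpleGraph V}
  {G' : SimpleGraph V'} {a b : V} {a' b' : V'} {m : ℕ}

/-- Since `{0, b}` is a subgroup, the remainder of `d` modulo `m` also sends `a` into it, and
minimality of `m` makes that remainder zero. -/
theorem dvd_of_smul (L : IsLadder G a b m) {d : ℤ} (h : d • a = 0 ∨ d • a = b) :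
    (m : ℤ) ∣ d := by
  have hm : (0 : ℤ) < m := by have := L.pos; omega
  have h1 : d % m = 0 := by
    have h0 := Int.emod_nonneg d hm.ne'
    have h1 := Int.emod_lt_of_pos d hm
    refine L.eq_zero_of_smul (by rwa [abs_of_nonneg h0]) ?_
    have h2 : (d / m) • ((m : ℤ) • a) = 0 ∨ (d / m) • ((m : ℤ) • a) = b := by
      rcases L.period with h | h <;> rw [h]
      · simp
      · obtain ⟨q, hq | hq⟩ := Int.even_or_odd' (d / m) <;>
          simp [hq, add_smul, mul_smul, two_smul, ← smul_add, L.two_b]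
    have h3 : (d % m) • a = d • a - (d / m) • ((m : ℤ) • a) := by
      rw [smul_smul, ← sub_smul]
      congr 1
      have := Int.emod_add_mul_ediv d m
      linarith
    rw [h3]
    have hb := L.neg_b
    rcases h with h | h <;> rcases h2 with h2 | h2 <;> rw [h, h2] <;> simp [hb]
  exact Int.dvd_of_emod_eq_zero h1

/-- A coincidence of coordinates forces `m ∣ k - l`; whether the rows agree then depends only on the
twist and the parity of the quotient, which are the same for both ladders. This makes the coordinate
map between ladders well defined. -/
theorem lad_eq_of_lad_eq (L : IsLadder G a b m) (L' : IsLadder G' a' b' m)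
    (h : (m : ℤ) • a = 0 ∧ (m : ℤ) • a' = 0 ∨ (m : ℤ) • a = b ∧ (m : ℤ) • a' = b')
    {k l : ℤ} {i j : Bool} (hkl : lad a b k i = lad a b l j) :
    lad a' b' k i = lad a' b' l j := by
  have h1 : (k - l) • a = if i = j then 0 else b := by
    have hb := L.neg_b
    rw [sub_smul]
    cases i <;> cases j <;> simp [lad] at hkl ⊢
    · rw [hkl, sub_self]
    · rw [hkl]; abel
    · rw [← hkl, ← sub_sub, sub_self, zero_sub, hb]
    · rw [hkl, sub_self]
  have h2 : (k - l) • a' = if i = j then 0 else b' := by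
    obtain ⟨q, hq⟩ := L.dvd_of_smul (d := k - l) (by rw [h1]; split_ifs <;> simp)
    rw [hq, mul_comm, mul_smul] at h1 ⊢
    have hb := L.b_ne
    rcases h with ⟨h, h'⟩ | ⟨h, h'⟩ <;> rw [h] at h1 <;> rw [h']
    · split_ifs at h1 ⊢
      · simp
      · simp [hb.symm] at h1
    · obtain ⟨r, rfl | rfl⟩ := Int.even_or_odd' q <;>
      · simp only [add_smul, mul_smul, two_smul, ← smul_add, L.two_b, L'.two_b, smul_zero,
          one_smul, zero_add] at h1 ⊢
        split_ifs at h1 ⊢ <;> simp_all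
  have hb := L'.two_b
  rw [sub_smul] at h2
  cases i <;> cases j <;> simp [lad, sub_eq_iff_eq_add] at h2 ⊢ <;> simp [h2]
  · exact add_comm _ _
  · rw [add_right_comm, hb, zero_add]

theorem adj_map (L : IsLadder G a b m) (L' : IsLadder G' a' b' m) (f : V → V')
    (hf : ∀ k i, f (lad a b k i) = lad a' b' k i) {x y : V} (hxy : G.Adj x y) :
    G'.Adj (f x) (f y) := by
  obtain ⟨k, i, -, -, rfl⟩ := L.exists_lad 0 x
  have hp : lad a b k i - a = lad a b (k - 1) i := by
    rw [sub_eq_iff_eq_add, ← lad_succ, sub_add_cancel]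
  rw [L.adj, ← lad_succ, ← L.lad_not, hp] at hxy
  rcases hxy with rfl | rfl | rfl <;> rw [hf, hf]
  · exact L'.adj_succ _ _
  · have := L'.adj_succ (k - 1) i
    rw [sub_add_cancel] at this
    exact this.symm
  · exact L'.adj_not _ _

/-- A ladder is determined by its length and by whether it is twisted. -/
theorem nonempty_iso (L : IsLadder G a b m) (L' : IsLadder G' a' b' m)
    (h : (m : ℤ) • a = 0 ∧ (m : ℤ) • a' = 0 ∨ (m : ℤ) • a = b ∧ (m : ℤ) • a' = b') :
    Nonempty (G ≃g G') := by
  have h' : (m : ℤ) • a' = 0 ∧ (m : ℤ) • a = 0 ∨ (m : ℤ) • a' = b' ∧ (m : ℤ) • a = b :=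
    h.imp And.symm And.symm
  choose k j _ _ hx using L.exists_lad 0
  choose k' j' _ _ hx' using L'.exists_lad 0
  have hf : ∀ c i, lad a' b' (k (lad a b c i)) (j (lad a b c i)) = lad a' b' c i :=
    fun c i => L.lad_eq_of_lad_eq L' h (hx _)
  have hg : ∀ c i, lad a b (k' (lad a' b' c i)) (j' (lad a' b' c i)) = lad a b c i :=
    fun c i => L'.lad_eq_of_lad_eq L h' (hx' _)
  refine ⟨⟨⟨fun x => lad a' b' (k x) (j x), fun x => lad a b (k' x) (j' x), fun x => ?_,
    fun x => ?_⟩, fun {x y} => ⟨fun hxy => ?_, L.adj_map L' _ hf⟩⟩⟩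
  · exact (hg _ _).trans (hx x)
  · exact (hf _ _).trans (hx' x)
  · have := L'.adj_map L (fun x => lad a b (k' x) (j' x)) hg hxy
    simpa only [Equiv.coe_fn_mk, hg, hx] using this

theorem comap (L : IsLadder G a b m) (φ : V' ≃+ V)
    (hφ : ∀ x y, G'.Adj x y ↔ G.Adj (φ x) (φ y)) : IsLadder G' (φ.symm a) (φ.symm b) m where
  adj x y := by
    rw [hφ, L.adj]
    simp only [← φ.injective.eq_iff (b := x + _), ← φ.injective.eq_iff (b := x - _), map_add,
      map_sub, AddEquiv.apply_symm_apply]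
  two_b := by rw [← map_add, L.two_b, map_zero]
  b_ne := by simpa using L.b_ne
  two_a := by simpa [← map_add] using L.two_a
  period := L.period.imp (fun h => by rw [← map_zsmul, h, map_zero])
    fun h => by rw [← map_zsmul, h]
  minimal d h0 h1 := by simpa [← map_zsmul] using L.minimal d h0 h1
  span x := by
    obtain ⟨k, h⟩ := L.span (φ x)
    refine ⟨k, h.imp (fun h => ?_) fun h => ?_⟩ <;> rw [← φ.symm_apply_apply x, h] <;> simp
  pos := L.pos

end Iso

/-- The group structure and the ladder are pulled back along `e`, so invariance of the two numbers
under isomorphism is not needed. -/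
theorem fed_lt_domNumber_of_iso {V V' : Type*} [AddCommGroup V] {G : SimpleGraph V}
    {a b : V} [Fintype V'] {G' : SimpleGraph V'} (e : G' ≃g G) {n : ℕ}
    (L : IsLadder G a b (2 * n)) (hn : lad a b (2 * (n : ℤ)) n.bodd = b) :
    fed G' < domNumber G' := by
  classical
  let _ : AddCommGroup V' := e.toEquiv.addCommGroup
  let φ : V' ≃+ V := e.toEquiv.addEquiv
  have L' := L.comap φ fun x y => e.map_adj_iff.symm
  refine L'.fed_lt_domNumber ?_
  apply φ.injective
  rw [AddEquiv.apply_symm_apply, ← hn]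
  nth_rewrite 1 [hn]
  cases n.bodd <;> simp [lad]

end IsLadder

/-! ### The prism and the Möbius ladder as ladders. -/

theorem addCayley_adj_iff {A : Type*} [AddCommGroup A] {S : Set A} (h0 : 0 ∉ S)
    (hneg : ∀ s ∈ S, -s ∈ S) (x y : A) : (addCayley S).Adj x y ↔ y - x ∈ S := by
  rw [addCayley_adj]
  have h1 : -y + x ∈ S ↔ y - x ∈ S := by
    refine ⟨fun h => ?_, fun h => ?_⟩ <;> have := hneg _ h
    · rwa [show -(-y + x) = y - x by abel] at this
    · rwa [show -(y - x) = -y + x by abel] at this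
  rw [h1, neg_add_eq_sub, or_self]
  refine ⟨fun h => h.2, fun h => ⟨?_, h⟩⟩
  rintro rfl
  exact h0 (by simpa using h)

theorem prism_period (n : ℕ) : (n : ℤ) • ((1, 0) : ZMod n × ZMod 2) = 0 := by
  ext <;> simp

theorem isLadder_prism {N : ℕ} (hN : 2 ≤ N) :
    IsLadder (V := ZMod (N + 1) × ZMod 2) (cycleGraph (N + 1) □ completeGraph (Fin 2))
      (1, 0) (0, 1) (N + 1) where
  adj x y := by
    -- Adjacency is computed over `Fin`, where `cycleGraph` lives, and then read over `ZMod`, which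
    -- agrees definitionally.
    have h (x y : Fin (N + 1) × Fin 2) : (cycleGraph (N + 1) □ completeGraph (Fin 2)).Adj x y ↔
        ((x.1 - y.1 = 1 ∨ y.1 - x.1 = 1) ∧ x.2 = y.2) ∨ (x.2 ≠ y.2 ∧ x.1 = y.1) := by
      rw [boxProd_adj]
      refine or_congr (and_congr ?_ Iff.rfl) Iff.rfl
      obtain ⟨M, rfl⟩ : ∃ M, N = M + 1 := ⟨N - 1, by omega⟩
      exact cycleGraph_adj
    refine Iff.trans (b := ((x.1 - y.1 = 1 ∨ y.1 - x.1 = 1) ∧ x.2 = y.2) ∨ (x.2 ≠ y.2 ∧ x.1 = y.1))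
      (h x y) ?_
    have h2 : ∀ i j : ZMod 2, i ≠ j ↔ j = i + 1 := by decide
    rw [h2]
    simp only [Prod.ext_iff, Prod.fst_add, Prod.snd_add, add_zero, sub_eq_iff_eq_add',
      eq_sub_iff_add_eq]
    constructor
    · rintro (⟨h | h, h'⟩ | ⟨h, h'⟩)
      · exact Or.inr (Or.inl ⟨h.symm, h'.symm⟩)
      · exact Or.inl ⟨h, h'.symm⟩
      · exact Or.inr (Or.inr ⟨h'.symm, h⟩)
    · rintro (⟨h, h'⟩ | ⟨h, h'⟩ | ⟨h, h'⟩)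
      · exact Or.inl ⟨Or.inr h, h'.symm⟩
      · exact Or.inl ⟨Or.inl h.symm, h'.symm⟩
      · exact Or.inr ⟨h', h.symm⟩
  two_b := by ext; · simp
              · exact (by decide : (1 : ZMod 2) + 1 = 0)
  b_ne h := absurd (congrArg Prod.snd h) (by decide : (1 : ZMod 2) ≠ 0)
  two_a h := by
    have h1 : ((2 : ℕ) : ZMod (N + 1)) = 0 := by
      have := congrArg Prod.fst h
      push_cast
      rw [← one_add_one_eq_two]
      exact this
    have := Nat.le_of_dvd (by norm_num) ((ZMod.natCast_eq_zero_iff _ _).1 h1)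
    omega
  period := Or.inl (prism_period (N + 1))
  minimal d h0 h1 := by
    have h2 : d • ((1, 0) : ZMod (N + 1) × ZMod 2) = ((d : ZMod (N + 1)), 0) := by ext <;> simp
    rw [h2]
    have h3 : (d : ZMod (N + 1)) ≠ 0 := by
      rw [ne_eq, ZMod.intCast_zmod_eq_zero_iff_dvd]
      intro h
      have := Int.le_of_dvd h0 h
      omega
    exact ⟨fun h => h3 (congrArg Prod.fst h), fun h => h3 (congrArg Prod.fst h)⟩
  span := by
    rintro ⟨x, i⟩
    obtain ⟨k, rfl⟩ := ZMod.intCast_surjective x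
    have hi : ∀ i : ZMod 2, i = 0 ∨ i = 1 := by decide
    refine ⟨k, (hi i).imp ?_ ?_⟩ <;> rintro rfl <;> simp
  pos := by omega

theorem isLadder_moebius {N : ℕ} (hN : 2 ≤ N) :
    IsLadder (addCayley ({1, -1, ((N : ℕ) : ZMod (2 * N))} : Set (ZMod (2 * N))))
      1 ((N : ℕ) : ZMod (2 * N)) N := by
  have hd : ∀ d : ℕ, 0 < d → d < 2 * N → ((d : ℕ) : ZMod (2 * N)) ≠ 0 := by
    intro d h0 h1
    rw [ne_eq, ZMod.natCast_eq_zero_iff]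
    exact Nat.not_dvd_of_pos_of_lt h0 h1
  have hNN : ((N : ℕ) : ZMod (2 * N)) + ((N : ℕ) : ZMod (2 * N)) = 0 := by
    have := ZMod.natCast_self (2 * N)
    rw [two_mul] at this
    push_cast at this ⊢
    rw [two_mul]
    exact this
  have h1 : ((1 : ℕ) : ZMod (2 * N)) ≠ 0 := hd 1 (by norm_num) (by omega)
  have hN0 := hd N (by omega) (by omega)
  rw [Nat.cast_one] at h1
  refine ⟨fun x y => ?_, hNN, hN0, ?_, Or.inr (by simp), fun d h0 h2 => ?_, fun x => ?_, hN⟩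
  · rw [addCayley_adj_iff]
    · simp only [Set.mem_insert_iff, Set.mem_singleton_iff, sub_eq_iff_eq_add', ← sub_eq_add_neg]
    · simp [h1, h1.symm, hN0.symm]
    · simp only [Set.mem_insert_iff, Set.mem_singleton_iff]
      rintro s (rfl | rfl | rfl)
      · simp
      · simp
      · exact Or.inr (Or.inr (neg_eq_of_add_eq_zero_left hNN))
  · have := hd 2 (by norm_num) (by omega)
    rw [one_add_one_eq_two]
    exact_mod_cast this
  · lift d to ℕ using h0.le
    have e : (d : ℤ) • (1 : ZMod (2 * N)) = (d : ℕ) := by simp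
    rw [e]
    refine ⟨hd d (by omega) (by omega), fun h => hd (d + N) (by omega) (by omega) ?_⟩
    rw [Nat.cast_add, h, hNN]
  · obtain ⟨k, rfl⟩ := ZMod.intCast_surjective x
    exact ⟨k, Or.inl (by simp)⟩


/-! ### Classification of the connection sets. -/

variable {V : Type*} [Fintype V] [AddCommGroup V] {G : SimpleGraph V} [DecidableRel G.Adj]
  {S : Set V}

omit [Fintype V] [AddCommGroup V] [DecidableRel G.Adj] in
theorem forall_of_connected (hconn : G.Connected) {P : V → Prop} {x : V} (hx : P x)
    (hP : ∀ u v, G.Adj u v → P u → P v) (y : V) : P y := by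
  obtain ⟨p⟩ := hconn.preconnected x y
  induction p with
  | nil => exact hx
  | cons h _ ih => exact ih (hP _ _ h hx)

-- The length is the least positive `m` with `m • a ∈ {0, b}`. Connectedness gives `span`, and `m =
-- 1` would force `2a = 0`.
omit [DecidableRel G.Adj] in
theorem exists_isLadder (hconn : G.Connected) {a b : V}
    (hadj : ∀ x y, G.Adj x y ↔ y = x + a ∨ y = x - a ∨ y = x + b) (hb : b + b = 0) (hb0 : b ≠ 0)
    (ha : a + a ≠ 0) : ∃ m, IsLadder G a b m := by
  classical
  have hex : ∃ m : ℕ, 0 < m ∧ ((m : ℤ) • a = 0 ∨ (m : ℤ) • a = b) :=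
    ⟨addOrderOf a, addOrderOf_pos a, Or.inl (by simp)⟩
  refine ⟨Nat.find hex, hadj, hb, hb0, ha, (Nat.find_spec hex).2, fun d h0 h1 => ?_, ?_, ?_⟩
  · lift d to ℕ using h0.le
    have := Nat.find_min hex (m := d) (by omega)
    refine ⟨fun h => this ⟨by omega, Or.inl h⟩, fun h => this ⟨by omega, Or.inr h⟩⟩
  · refine forall_of_connected hconn ⟨0, Or.inl (zero_smul ℤ a).symm⟩ fun u v huv => ?_
    rintro ⟨k, h⟩
    rw [hadj] at huv
    rcases huv with rfl | rfl | rfl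
    · refine ⟨k + 1, h.imp ?_ ?_⟩ <;> rintro rfl <;> rw [add_smul, one_smul]
      abel
    · refine ⟨k - 1, h.imp ?_ ?_⟩ <;> rintro rfl <;> rw [sub_smul, one_smul]
      abel
    · refine ⟨k, h.symm.imp ?_ ?_⟩ <;> rintro rfl
      · rw [add_assoc, hb, add_zero]
      · rfl
  · have h := Nat.find_spec hex
    by_contra! hlt
    have h1 : Nat.find hex = 1 := by omega
    rw [h1, Nat.cast_one, one_smul] at h
    rcases h.2 with h | h
    · exact ha (by rw [h, add_zero])
    · exact ha (by rw [h, hb])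

/-- When all three generators are involutions, `G` is `K₄` or the cube, which has a perfect
dominating set. -/
theorem domNumber_le_fed_of_involutions (hconn : G.Connected) (hreg : G.IsRegularOfDegree 3)
    {x y z : V} (hadj : ∀ u v, G.Adj u v ↔ v = u + x ∨ v = u + y ∨ v = u + z)
    (hx : x + x = 0) (hy : y + y = 0) (hz : z + z = 0) (hx0 : x ≠ 0) (hy0 : y ≠ 0) (hz0 : z ≠ 0)
    (hxy : x ≠ y) (hxz : x ≠ z) (hyz : y ≠ z) : (domNumber G : ℝ) ≤ fed G := by
  classical
  have hS : EternallyFracDominated G (domNumber G : ℝ) :=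
    eternallyFracDominated_domNumber (S := {x, y, z}) fun u v => by
      simp only [hadj, Set.mem_insert_iff, Set.mem_singleton_iff, sub_eq_iff_eq_add']
  have hmem : ∀ u v, v ∈ closedNbhd G u ↔ v = u ∨ v = u + x ∨ v = u + y ∨ v = u + z :=
    fun u v => by rw [mem_closedNbhd, hadj]
  by_cases hxyz : x + y + z = 0
  -- Here `z = x + y`, so the graph is `K₄` and one vertex dominates it.
  · refine domNumber_le_fed_of_perfect hreg hS 0 (D := {0}) ?_ ?_
    · refine forall_of_connected (x := 0) hconn ?_ fun u v huv => ?_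
      · simp
      · rw [hadj] at huv
        simp only [Finset.mem_singleton, exists_eq_left, hadj, zero_add]
        grind
    · rw [Finset.card_singleton, mul_one, ← card_closedNbhd hreg (0 : V)]
      exact Finset.card_le_univ _
  -- This is the cube: two antipodal vertices dominate, and their disjoint closed neighbourhoods
  -- show `8 ≤ |V|`.
  · refine domNumber_le_fed_of_perfect hreg hS 0 (D := {0, x + y + z}) ?_ ?_
    · refine forall_of_connected (x := 0) hconn ⟨0, by simp, Or.inl rfl⟩ fun u v huv => ?_
      rw [hadj] at huv
      simp only [Finset.mem_insert, Finset.mem_singleton, exists_eq_or_imp, exists_eq_left, hadj,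
        zero_add]
      grind
    · have hdisj : Disjoint (closedNbhd G 0) (closedNbhd G (x + y + z)) := by
        rw [Finset.disjoint_left]
        intro u hu hu'
        rw [hmem] at hu hu'
        grind
      have h1 := Finset.card_le_univ (closedNbhd G 0 ∪ closedNbhd G (x + y + z))
      rw [Finset.card_union_of_disjoint hdisj, card_closedNbhd hreg, card_closedNbhd hreg] at h1
      have h2 : ({0, x + y + z} : Finset V).card ≤ 2 := Finset.card_le_two
      omega

/-- If some generator `a` is not an involution, then `a` and `-a` are two of the three generators,
and the third must be its own inverse. -/
theorem exists_isLadder_or (hconn : G.Connected) (hreg : G.IsRegularOfDegree 3)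
    (hadj : ∀ x y, G.Adj x y ↔ y - x ∈ S) (h0 : (0 : V) ∉ S) (hneg : ∀ s ∈ S, -s ∈ S) :
    (∃ a b m, IsLadder G a b m) ∨ (domNumber G : ℝ) ≤ fed G := by
  classical
  have hT : ∀ s, s ∈ G.neighborFinset 0 ↔ s ∈ S := fun s => by
    rw [mem_neighborFinset, hadj, sub_zero]
  have hc : (G.neighborFinset 0).card = 3 := by rw [card_neighborFinset_eq_degree, hreg 0]
  by_cases hinv : ∀ s ∈ S, s + s = 0
  · right
    obtain ⟨x, y, z, hxy, hxz, hyz, h⟩ := Finset.card_eq_three.1 hc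
    have hS : ∀ s, s ∈ S ↔ s = x ∨ s = y ∨ s = z := fun s => by simp [← hT, h]
    have hx : x ∈ S := (hS x).2 (by simp)
    have hy : y ∈ S := (hS y).2 (by simp)
    have hz : z ∈ S := (hS z).2 (by simp)
    refine domNumber_le_fed_of_involutions hconn hreg (x := x) (y := y) (z := z) (fun u v => ?_)
      (hinv x hx) (hinv y hy) (hinv z hz) ?_ ?_ ?_ hxy hxz hyz
    · simp only [hadj, hS, sub_eq_iff_eq_add']
    all_goals rintro rfl; exact h0 ‹_›
  · left
    push Not at hinv
    obtain ⟨a, ha, haa⟩ := hinv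
    have hna : -a ≠ a := fun h => haa (by nth_rewrite 1 [← h]; simp)
    have hc1 : (((G.neighborFinset 0).erase a).erase (-a)).card = 1 := by
      rw [Finset.card_erase_of_mem, Finset.card_erase_of_mem, hc]
      · exact (hT a).2 ha
      · exact Finset.mem_erase.2 ⟨hna, (hT _).2 (hneg a ha)⟩
    obtain ⟨b, hb⟩ := Finset.card_eq_one.1 hc1
    have hb' : ∀ s, (s ≠ -a ∧ s ≠ a ∧ s ∈ S) ↔ s = b := fun s => by
      rw [← Finset.mem_singleton, ← hb, Finset.mem_erase, Finset.mem_erase, hT]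
    obtain ⟨h1, h2, h3⟩ := (hb' b).2 rfl
    have hbb : -b = b := (hb' (-b)).1 ⟨fun h => h2 (neg_injective h),
      fun h => h1 (by rw [← h, neg_neg]), hneg b h3⟩
    have hS : ∀ s, s ∈ S ↔ s = a ∨ s = -a ∨ s = b := by
      intro s
      have h4 := hneg a ha
      constructor
      · intro h
        have := hb' s
        tauto
      · rintro (rfl | rfl | rfl) <;> assumption
    obtain ⟨m, L⟩ := exists_isLadder hconn (a := a) (b := b) (fun x y => by
      simp only [hadj, hS, sub_eq_iff_eq_add', ← sub_eq_add_neg])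
      (by nth_rewrite 1 [← hbb]; simp) (fun h => h0 (h ▸ h3)) haa
    exact ⟨a, b, m, L⟩

/-- The ladders that are not perfectly dominated are the untwisted ones of length `4 * k + 2` and
the twisted ones of length `4 * k`. -/
theorem exists_iso_of_fed_lt (hconn : G.Connected) (hreg : G.IsRegularOfDegree 3)
    (hadj : ∀ x y, G.Adj x y ↔ y - x ∈ S) (h0 : (0 : V) ∉ S) (hneg : ∀ s ∈ S, -s ∈ S)
    (hlt : fed G < domNumber G) : ∃ k : ℕ, 1 ≤ k ∧
      (Nonempty (G ≃g cycleGraph (4 * k + 2) □ completeGraph (Fin 2)) ∨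
        Nonempty (G ≃g addCayley ({1, -1, ((4 * k : ℕ) : ZMod (8 * k))} : Set (ZMod (8 * k))))) := by
  obtain ⟨a, b, m, L⟩ := (exists_isLadder_or hconn hreg hadj h0 hneg).resolve_right hlt.not_ge
  obtain ⟨n, rfl | rfl⟩ := Nat.even_or_odd' m
  swap
  · exact absurd L.domNumber_le_fed_of_odd hlt.not_ge
  have hn : lad a b (2 * (n : ℤ)) n.bodd ≠ 0 := fun h =>
    absurd (L.domNumber_le_fed_of_even h) hlt.not_ge
  have hpos := L.pos
  have hper := L.period
  push_cast at hper
  obtain ⟨k, rfl | rfl⟩ := Nat.even_or_odd' n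
  · have h : ((2 * (2 * k) : ℕ) : ℤ) • a = b := by
      push_cast at hn ⊢
      refine hper.resolve_left fun h => hn ?_
      simpa [lad] using h
    refine ⟨k, by omega, Or.inr ?_⟩
    obtain rfl | hk := Nat.eq_zero_or_pos k
    · omega
    have M := isLadder_moebius (N := 2 * (2 * k)) (by omega)
    rw [show 2 * (2 * (2 * k)) = 8 * k by ring] at M
    rw [show 4 * k = 2 * (2 * k) by ring]
    exact L.nonempty_iso M (Or.inr ⟨h, by simp⟩)
  · have h : ((2 * (2 * k + 1) : ℕ) : ℤ) • a = 0 := by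
      push_cast at hn ⊢
      refine hper.resolve_right fun h => hn ?_
      push_cast at h
      simp [lad, h, L.two_b]
    have hk : 1 ≤ k := by
      by_contra! hk
      obtain rfl : k = 0 := by omega
      exact L.two_a (by simpa [two_smul] using h)
    refine ⟨k, hk, Or.inl ?_⟩
    have M := isLadder_prism (N := 4 * k + 1) (by omega)
    rw [show 2 * (2 * k + 1) = 4 * k + 1 + 1 by ring] at L h
    refine L.nonempty_iso M (Or.inl ⟨h, prism_period _⟩)

end EternalDomination

theorem mainTheorem1 {V : Type*} [Fintype V] (G : SimpleGraph V) [DecidableRel G.Adj]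
    (hconn : G.Connected) (hcubic : G.IsRegularOfDegree 3)
    (hG : EternalDomination.IsAbelianCayleyGraph G) :
    EternalDomination.fed G ≤ (EternalDomination.domNumber G : ℝ) ∧
    EternalDomination.domNumber G = EternalDomination.mEternalDomNumber G ∧
    (EternalDomination.fed G < (EternalDomination.domNumber G : ℝ) ↔
      ∃ k : ℕ, 1 ≤ k ∧
        (Nonempty (G ≃g cycleGraph (4 * k + 2) □ completeGraph (Fin 2)) ∨
          Nonempty (G ≃g addCayley ({1, -1, ((4 * k : ℕ) : ZMod (8 * k))} : Set (ZMod (8 * k)))))) := by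
  open EternalDomination in
  obtain ⟨A, _, S, h0, hneg, ⟨e⟩⟩ := hG
  -- The group structure is transported to the vertex set, so that `G` itself is a Cayley graph.
  let _ : AddCommGroup V := e.toEquiv.addCommGroup
  let φ : V ≃+ A := e.toEquiv.addEquiv
  have hadj : ∀ x y, G.Adj x y ↔ y - x ∈ φ ⁻¹' S := by
    intro x y
    rw [← e.map_adj_iff, addCayley_adj_iff h0 hneg, Set.mem_preimage, map_sub]
    rfl
  refine ⟨fed_le (eternallyFracDominated_domNumber hadj), domNumber_eq_mEternalDomNumber hadj,
    fun h => exists_iso_of_fed_lt hconn hcubic hadj ?_ (fun s hs => ?_) h, ?_⟩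
  · rwa [Set.mem_preimage, map_zero]
  · rw [Set.mem_preimage, map_neg]
    exact hneg _ hs
  · rintro ⟨k, hk, ⟨⟨f⟩⟩ | ⟨⟨f⟩⟩⟩
    · have hk2 : 4 * k + 1 + 1 = 2 * (2 * k + 1) := by ring
      have M : IsLadder (V := ZMod (4 * k + 2) × ZMod 2) (cycleGraph (4 * k + 2) □
          completeGraph (Fin 2)) (1, 0) (0, 1) (2 * (2 * k + 1)) :=
        hk2 ▸ isLadder_prism (N := 4 * k + 1) (by omega)
      refine M.fed_lt_domNumber_of_iso f ?_
      have h := prism_period (4 * k + 2)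
      rw [show ((4 * k + 2 : ℕ) : ℤ) = 2 * ((2 * k + 1 : ℕ) : ℤ) by push_cast; ring] at h
      change (2 * ((2 * k + 1 : ℕ) : ℤ)) • ((1, 0) : ZMod (4 * k + 2) × ZMod 2) + _ = _
      rw [h]
      simp
    · have M := isLadder_moebius (N := 2 * (2 * k)) (by omega)
      rw [show 2 * (2 * (2 * k)) = 8 * k by ring, show 2 * (2 * k) = 4 * k by ring] at M
      have M' : IsLadder (addCayley ({1, -1, ((4 * k : ℕ) : ZMod (8 * k))} : Set (ZMod (8 * k))))
        1 ((4 * k : ℕ) : ZMod (8 * k)) (2 * (2 * k)) := by convert M using 1; ring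
      refine M'.fed_lt_domNumber_of_iso f ?_
      simp [lad]
      ring
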